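/- For $p>0$ and $x\in(0,\pi/2)$ let $$\varphi_p(x)=\frac{3x}{\sin x}+\cos x-4-\frac{x^4}{10}-p\,x^6,\qquad A=\frac1{210},\qquad B=\frac{480\pi-2\pi^4-1280}{5\pi^6}.$$ For every $p\in(A,B)$ the function $\varphi_p$ attains its minimum on $(0,\pi/2)$ at a point $t^{(p)}$, which is the only local extremum point of $\varphi_p$ in $(0,\pi/2)$. There is exactly one $p_0\in(A,B)$ that solves the equation $$\bigl|\varphi_p(t^{(p)})\bigr|=\varphi_p\!\left(\tfrac{\pi}{2}-\right),$$ where the right-hand side is the left limit of $\varphi_p$ at $\pi/2$; numerically $p_0=0.0066982\ldots$, i.e. $0.0066982\le p_0<0.0066983$. For $$d_0=\bigl|\varphi_{p_0}(t^{(p_0)})\bigr|=\varphi_{p_0}\!\left(\tfrac{\pi}{2}-\right)=0.0029637\ldots$$ (i.e. $0.0029637\le d_0<0.0029638$) one has $$d_0=\inf_{p>0}\ \sup_{x\in(0,\pi/2)}|\varphi_p(x)|,$$ and $p_0$ is the unique $p>0$ at which this infimum is attained; that is, $\varphi_{p_0}$ is the minimax approximant of the family on $(0,\pi/2)$, and it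 determines the minimax approximation $\frac{3x}{\sin x}+\cos x\approx 4+\frac{x^4}{10}+p_0x^6$. -/

import Mathlib

open Set Filter Topology

/-- The error `d^(p) = sup_{x ∈ (a,b)} |φ_p(x)|` of the member `φ_p` of a family, taken in the
extended reals (so that no boundedness convention enters). -/
noncomputable def familyError (φ : ℝ → ℝ → ℝ) (a b p : ℝ) : EReal :=
  ⨆ x ∈ Ioo a b, ((|φ p x| : ℝ) : EReal)

/-- The minimax error `inf_{p > 0} sup_{x ∈ (a,b)} |φ_p(x)|` of a family. -/
noncomputable def minimaxError (φ : ℝ → ℝ → ℝ) (a b : ℝ) : EReal :=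
  ⨅ p ∈ Ioi (0 : ℝ), familyError φ a b p

/-- `φ_{p₀}` is the minimax approximant of the family on `(a, b)`: `p₀` is the unique positive
parameter at which the infimum of the errors is attained. -/
def IsMinimaxApproximant (φ : ℝ → ℝ → ℝ) (a b p₀ : ℝ) : Prop :=
  0 < p₀ ∧ familyError φ a b p₀ = minimaxError φ a b ∧
    ∀ p : ℝ, 0 < p → familyError φ a b p = minimaxError φ a b → p = p₀

/-- `t` is a point of `(a, b)` at which `f` attains its minimum over `(a, b)`. -/
def IsMinPoint (f : ℝ → ℝ) (a b t : ℝ) : Prop :=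
  t ∈ Ioo a b ∧ IsMinOn f (Ioo a b) t

/-- The equation `|φ_p(t^(p))| = φ_p(b-)`: the minimum of `φ_p` over `(a, b)` is attained at some
point `t`, and the left limit of `φ_p` at `b` exists and equals `|φ_p(t)|`. -/
def SolvesBalanceEquation (φ : ℝ → ℝ → ℝ) (a b p : ℝ) : Prop :=
  ∃ t : ℝ, IsMinPoint (φ p) a b t ∧ Tendsto (φ p) (𝓝[<] b) (𝓝 |φ p t|)

/-- The family `φ_p(x) = 3 x / sin x + cos x - 4 - x⁴ / 10 - p x⁶`, used for `x ∈ (0, π/2)`. -/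
noncomputable def cusaFamily (p x : ℝ) : ℝ :=
  3 * (x / Real.sin x) + Real.cos x - 4 - x ^ 4 / 10 - p * x ^ 6

/-- The constant `A = 1/210`. -/
noncomputable def cusaA : ℝ := 1 / 210

/-- The constant `B = (480 π - 2 π⁴ - 1280) / (5 π⁶)`. -/
noncomputable def cusaB : ℝ :=
  (480 * Real.pi - 2 * Real.pi ^ 4 - 1280) / (5 * Real.pi ^ 6)

/-! Write φ_p = g - p x⁶ with g = `cusaBase`. In the variable u = x⁶ the function g is strictly
convex: dg/du = `cusaSlope` increases strictly (`strictMonoOn_cusaSlope`), so φ_p has at most one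
critical point. Since g ~ A x⁶ at 0 and B is the slope of the chord of g over [0, (π/2)⁶], for A < p
< B the minimum is interior and negative, and the supremum of φ_p is its endpoint value.

The balanced p₀ is the minimum of (g(x) + g(π/2)) / (x⁶ + (π/2)⁶), attained at t₀
(`exists_balanced`): minimality says exactly that φ_{p₀} ≥ -d₀, with equality at t₀. Lowering p
raises the endpoint value above d₀, and raising p pushes φ_p(t₀) below -d₀, so every other p has a
larger error. A tangent in u near t₀ gives the digits. -/

/-! ### Alternating Taylor bounds for sine and cosine -/

/-- The sum of the first `n` terms of the Taylor series of `sin`. -/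
noncomputable def sinTaylor (n : ℕ) (x : ℝ) : ℝ :=
  ∑ k ∈ Finset.range n, (-1 : ℝ) ^ k * x ^ (2 * k + 1) / (2 * k + 1).factorial

/-- The sum of the first `n` terms of the Taylor series of `cos`. -/
noncomputable def cosTaylor (n : ℕ) (x : ℝ) : ℝ :=
  ∑ k ∈ Finset.range n, (-1 : ℝ) ^ k * x ^ (2 * k) / (2 * k).factorial

lemma hasDerivAt_sinTaylor (n : ℕ) (x : ℝ) :
    HasDerivAt (sinTaylor n) (cosTaylor n x) x := by
  unfold sinTaylor cosTaylor
  refine HasDerivAt.fun_sum fun k _ => ?_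
  have h := ((hasDerivAt_pow (2 * k + 1) x).const_mul ((-1 : ℝ) ^ k)).div_const
    ((2 * k + 1).factorial : ℝ)
  refine h.congr_deriv ?_
  rw [Nat.factorial_succ]
  have : ((2 * k).factorial : ℝ) ≠ 0 := by positivity
  push_cast
  field_simp

lemma hasDerivAt_cosTaylor (n : ℕ) (x : ℝ) :
    HasDerivAt (cosTaylor (n + 1)) (-sinTaylor n x) x := by
  unfold sinTaylor cosTaylor
  simp only [Finset.sum_range_succ' _ n]
  rw [← Finset.sum_neg_distrib]
  simp only [mul_zero, pow_zero, mul_one]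
  refine HasDerivAt.add_const _ (HasDerivAt.fun_sum fun k _ => ?_)
  have h := ((hasDerivAt_pow (2 * k + 2) x).const_mul ((-1 : ℝ) ^ (k + 1))).div_const
    ((2 * k + 2).factorial : ℝ)
  refine h.congr_deriv ?_
  rw [Nat.factorial_succ (2 * k + 1)]
  have : ((2 * k + 1).factorial : ℝ) ≠ 0 := by positivity
  push_cast
  field_simp
  rw [pow_succ]
  simp
  ring

lemma nonneg_of_hasDerivAt_nonneg {f f' : ℝ → ℝ} (hf : ∀ x, HasDerivAt f (f' x) x)
    (h0 : f 0 = 0) (hf' : ∀ x, 0 ≤ x → 0 ≤ f' x) {x : ℝ} (hx : 0 ≤ x) : 0 ≤ f x := by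
  have hmono : MonotoneOn f (Ici 0) := by
    refine monotoneOn_of_deriv_nonneg (convex_Ici 0)
      (fun y _ => (hf y).continuousAt.continuousWithinAt)
      (fun y _ => (hf y).differentiableAt.differentiableWithinAt) fun y hy => ?_
    rw [interior_Ici] at hy
    rw [(hf y).deriv]
    exact hf' y (le_of_lt hy)
  simpa [h0] using hmono (mem_Ici.2 le_rfl) (mem_Ici.2 hx) hx

/-- Starting from cos ≤ 1, integrate from 0 repeatedly: the cosine error is the derivative of the
sine error, and minus the sine error is the derivative of the next cosine error. -/
lemma sin_cos_taylor_sign (n : ℕ) :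
    (∀ x : ℝ, 0 ≤ x → 0 ≤ (-1 : ℝ) ^ (n + 1) * (Real.cos x - cosTaylor (n + 1) x)) ∧
      ∀ x : ℝ, 0 ≤ x → 0 ≤ (-1 : ℝ) ^ (n + 1) * (Real.sin x - sinTaylor (n + 1) x) := by
  have sin_step : ∀ n,
      (∀ x : ℝ, 0 ≤ x → 0 ≤ (-1 : ℝ) ^ (n + 1) * (Real.cos x - cosTaylor (n + 1) x)) →
      ∀ x : ℝ, 0 ≤ x → 0 ≤ (-1 : ℝ) ^ (n + 1) * (Real.sin x - sinTaylor (n + 1) x) :=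
    fun n h x hx => nonneg_of_hasDerivAt_nonneg
      (f := fun x => (-1 : ℝ) ^ (n + 1) * (Real.sin x - sinTaylor (n + 1) x))
      (fun y => ((Real.hasDerivAt_sin y).sub (hasDerivAt_sinTaylor (n + 1) y)).const_mul _)
      (by simp [sinTaylor]) h hx
  induction n with
  | zero =>
    have h : ∀ x : ℝ, 0 ≤ x → 0 ≤ (-1 : ℝ) ^ (0 + 1) * (Real.cos x - cosTaylor (0 + 1) x) :=
      fun x _ => by simpa [cosTaylor] using Real.cos_le_one x
    exact ⟨h, sin_step 0 h⟩
  | succ n ih =>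
    have h : ∀ x : ℝ, 0 ≤ x →
        0 ≤ (-1 : ℝ) ^ (n + 1 + 1) * (Real.cos x - cosTaylor (n + 1 + 1) x) := by
      intro x hx
      refine nonneg_of_hasDerivAt_nonneg
        (f := fun x => (-1 : ℝ) ^ (n + 1 + 1) * (Real.cos x - cosTaylor (n + 1 + 1) x))
        (fun y => ((Real.hasDerivAt_cos y).sub (hasDerivAt_cosTaylor (n + 1) y)).const_mul _)
        (by simp [cosTaylor, Finset.sum_range_succ']) (fun y hy => ?_) hx
      have := ih.2 y hy
      rw [pow_succ]
      linarith
    exact ⟨h, sin_step (n + 1) h⟩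

/-- Here and in the next three lemmas n indexes the last term kept, whose sign (-1)ⁿ decides the
direction. -/
lemma sinTaylor_le_sin {n : ℕ} (hn : Odd n) {x : ℝ} (hx : 0 ≤ x) :
    sinTaylor (n + 1) x ≤ Real.sin x := by
  simpa [hn.add_one.neg_one_pow] using (sin_cos_taylor_sign n).2 x hx

lemma sin_le_sinTaylor {n : ℕ} (hn : Even n) {x : ℝ} (hx : 0 ≤ x) :
    Real.sin x ≤ sinTaylor (n + 1) x := by
  simpa [hn.add_one.neg_one_pow] using (sin_cos_taylor_sign n).2 x hx

lemma cosTaylor_le_cos {n : ℕ} (hn : Odd n) {x : ℝ} (hx : 0 ≤ x) :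
    cosTaylor (n + 1) x ≤ Real.cos x := by
  simpa [hn.add_one.neg_one_pow] using (sin_cos_taylor_sign n).1 x hx

lemma cos_le_cosTaylor {n : ℕ} (hn : Even n) {x : ℝ} (hx : 0 ≤ x) :
    Real.cos x ≤ cosTaylor (n + 1) x := by
  simpa [hn.add_one.neg_one_pow] using (sin_cos_taylor_sign n).1 x hx

/-! ### The part of the family that does not depend on the parameter -/

/-- The continuous extension of `3 x / sin x + cos x - 4 - x⁴ / 10` to `x = 0`. -/
noncomputable def cusaBase (x : ℝ) : ℝ :=
  3 / Real.sinc x + Real.cos x - 4 - x ^ 4 / 10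

/-- The derivative of `cusaBase` with respect to `x⁶`. -/
noncomputable def cusaSlope (x : ℝ) : ℝ :=
  (3 / Real.sin x - 3 * x * Real.cos x / Real.sin x ^ 2 - Real.sin x - 2 * x ^ 3 / 5) /
    (6 * x ^ 5)

lemma cusaBase_of_ne_zero {x : ℝ} (hx : x ≠ 0) :
    cusaBase x = 3 * (x / Real.sin x) + Real.cos x - 4 - x ^ 4 / 10 := by
  rw [cusaBase, Real.sinc_of_ne_zero hx, div_div_eq_mul_div, mul_div_assoc]

lemma cusaFamily_eq (p : ℝ) {x : ℝ} (hx : x ≠ 0) :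
    cusaFamily p x = cusaBase x - p * x ^ 6 := by
  rw [cusaFamily, cusaBase_of_ne_zero hx]

lemma cusaBase_zero : cusaBase 0 = 0 := by
  norm_num [cusaBase]

lemma sin_pos_of_mem {x : ℝ} (h0 : 0 < x) (h1 : x ≤ Real.pi / 2) : 0 < Real.sin x :=
  Real.sin_pos_of_pos_of_lt_pi h0 (by linarith [Real.pi_pos])

lemma continuousOn_cusaBase : ContinuousOn cusaBase (Icc 0 (Real.pi / 2)) := by
  have h : ∀ x ∈ Icc 0 (Real.pi / 2), Real.sinc x ≠ 0 := by
    rintro x ⟨h0, h1⟩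
    rcases h0.eq_or_lt with rfl | h0
    · simp
    · rw [Real.sinc_of_ne_zero h0.ne']
      exact (div_pos (sin_pos_of_mem h0 h1) h0).ne'
  unfold cusaBase
  exact (((continuousOn_const.div Real.continuous_sinc.continuousOn h).add
    Real.continuous_cos.continuousOn).sub continuousOn_const).sub (by fun_prop)

lemma hasDerivAt_cusaBase {x : ℝ} (h0 : 0 < x) (h1 : x ≤ Real.pi / 2) :
    HasDerivAt cusaBase (cusaSlope x * (6 * x ^ 5)) x := by
  have hs := (sin_pos_of_mem h0 h1).ne'
  have h := (((((hasDerivAt_id x).div (Real.hasDerivAt_sin x) hs).const_mul 3).add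
    (Real.hasDerivAt_cos x)).sub_const 4).sub ((hasDerivAt_pow 4 x).div_const 10)
  refine (h.congr_deriv ?_).congr_of_eventuallyEq ?_
  · simp only [cusaSlope, id]
    field_simp
    push_cast
    ring
  · filter_upwards [eventually_ne_nhds h0.ne'] with y hy
    simp [cusaBase_of_ne_zero hy]

/-- This is the numerator of the derivative of `cusaSlope`. Linearised in multiple angles, each term
can be bounded by its own Taylor polynomial; everything below x¹⁰ cancels. -/
lemma slope_numerator_pos {x : ℝ} (h0 : 0 < x) (h1 : x ≤ Real.pi / 2) :
    0 < 9 * x * Real.sin x * Real.cos x + 6 * x ^ 2 - 3 * x ^ 2 * Real.sin x ^ 2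
      - 15 * Real.sin x ^ 2 - x * Real.cos x * Real.sin x ^ 3 + 5 * Real.sin x ^ 4
      + 4 / 5 * x ^ 3 * Real.sin x ^ 3 := by
  have key : 9 * x * Real.sin x * Real.cos x + 6 * x ^ 2 - 3 * x ^ 2 * Real.sin x ^ 2
      - 15 * Real.sin x ^ 2 - x * Real.cos x * Real.sin x ^ 3 + 5 * Real.sin x ^ 4
      + 4 / 5 * x ^ 3 * Real.sin x ^ 3 =
      17 / 4 * x * Real.sin (2 * x) + 1 / 8 * x * Real.sin (4 * x)
      + (3 / 2 * x ^ 2 + 5) * Real.cos (2 * x) + 5 / 8 * Real.cos (4 * x)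
      + 9 / 2 * x ^ 2 - 45 / 8 + x ^ 3 * (3 / 5 * Real.sin x - 1 / 5 * Real.sin (3 * x)) := by
    rw [show 4 * x = 2 * (2 * x) by ring, Real.sin_two_mul (2 * x), Real.cos_two_mul (2 * x),
      Real.sin_three_mul, Real.sin_two_mul, Real.cos_two_mul']
    have hc : Real.cos x ^ 2 = 1 - Real.sin x ^ 2 := by rw [Real.cos_sq']
    have hc3 : Real.cos x ^ 3 = (1 - Real.sin x ^ 2) * Real.cos x := by rw [← hc]; ring
    have hc4 : Real.cos x ^ 4 = (1 - Real.sin x ^ 2) ^ 2 := by rw [← hc]; ring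
    ring_nf
    simp only [hc, hc3, hc4]
    ring
  rw [key]
  have s1 := sinTaylor_le_sin (n := 3) (by decide) h0.le
  have s2 := sinTaylor_le_sin (n := 5) (by decide) (x := 2 * x) (by linarith)
  have s3 := sin_le_sinTaylor (n := 6) (by decide) (x := 3 * x) (by linarith)
  -- Larger multiples of x converge more slowly and need more terms. Only sin 3x has a negative
  -- coefficient, hence its upper bound.
  have s4 := sinTaylor_le_sin (n := 9) (by decide) (x := 4 * x) (by linarith)
  have c2 := cosTaylor_le_cos (n := 5) (by decide) (x := 2 * x) (by linarith)
  have c4 := cosTaylor_le_cos (n := 9) (by decide) (x := 4 * x) (by linarith)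
  have e2 := mul_le_mul_of_nonneg_left s2 (show 0 ≤ 17 / 4 * x by positivity)
  have e4 := mul_le_mul_of_nonneg_left s4 (show 0 ≤ 1 / 8 * x by positivity)
  have ec2 := mul_le_mul_of_nonneg_left c2 (show 0 ≤ 3 / 2 * x ^ 2 + 5 by positivity)
  have e13 := mul_le_mul_of_nonneg_left
    (show 3 / 5 * sinTaylor (3 + 1) x - 1 / 5 * sinTaylor (6 + 1) (3 * x) ≤
      3 / 5 * Real.sin x - 1 / 5 * Real.sin (3 * x) by linarith)
    (show 0 ≤ x ^ 3 by positivity)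
  refine lt_of_lt_of_le ?_ (show 17 / 4 * x * sinTaylor (5 + 1) (2 * x)
      + 1 / 8 * x * sinTaylor (9 + 1) (4 * x)
      + (3 / 2 * x ^ 2 + 5) * cosTaylor (5 + 1) (2 * x) + 5 / 8 * cosTaylor (9 + 1) (4 * x)
      + 9 / 2 * x ^ 2 - 45 / 8
      + x ^ 3 * (3 / 5 * sinTaylor (3 + 1) x - 1 / 5 * sinTaylor (6 + 1) (3 * x)) ≤ _ by
    linarith)
  have hy : x ^ 2 ≤ 2.468 := by
    have : x ≤ 1.5708 := h1.trans (by linarith [Real.pi_lt_d6])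
    nlinarith
  have hy0 : 0 ≤ x ^ 2 := sq_nonneg x
  have h3 : (x ^ 2) ^ 3 ≤ 2.468 ^ 3 := pow_le_pow_left₀ hy0 hy 3
  have h4 : (x ^ 2) ^ 4 ≤ 2.468 ^ 4 := pow_le_pow_left₀ hy0 hy 4
  have h5 : (x ^ 2) ^ 5 ≤ 2.468 ^ 5 := pow_le_pow_left₀ hy0 hy 5
  have hpos : 0 < (11/1050
      - 163651/59875200 * x ^ 2
      + 5634617/18162144000 * (x ^ 2) ^ 2
      - 16703567/653837184000 * (x ^ 2) ^ 3
      - 65536/97692469875 * (x ^ 2) ^ 4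
      - 524288/1856156927625 * (x ^ 2) ^ 5) := by
    norm_num at h3 h4 h5
    nlinarith
  refine lt_of_lt_of_eq (mul_pos (pow_pos h0 10) hpos) ?_
  simp only [sinTaylor, cosTaylor, Finset.sum_range_succ, Finset.sum_range_zero, Nat.factorial]
  push_cast
  ring

lemma strictMonoOn_cusaSlope : StrictMonoOn cusaSlope (Ioo 0 (Real.pi / 2)) := by
  have hd : ∀ x ∈ Ioo 0 (Real.pi / 2), HasDerivAt cusaSlope
      ((9 * x * Real.sin x * Real.cos x + 6 * x ^ 2 - 3 * x ^ 2 * Real.sin x ^ 2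
      - 15 * Real.sin x ^ 2 - x * Real.cos x * Real.sin x ^ 3 + 5 * Real.sin x ^ 4
      + 4 / 5 * x ^ 3 * Real.sin x ^ 3) / (6 * x ^ 6 * Real.sin x ^ 3)) x := by
    rintro x ⟨h0, h1⟩
    have hs := (sin_pos_of_mem h0 h1.le).ne'
    have hx := h0.ne'
    have h := (((((hasDerivAt_const x (3 : ℝ)).div (Real.hasDerivAt_sin x) hs).sub
      ((((hasDerivAt_id x).const_mul 3).mul (Real.hasDerivAt_cos x)).div
        ((Real.hasDerivAt_sin x).pow 2) (pow_ne_zero 2 hs))).sub (Real.hasDerivAt_sin x)).sub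
      (((hasDerivAt_pow 3 x).const_mul 2).div_const 5)).div
      ((hasDerivAt_pow 5 x).const_mul 6) (by positivity)
    refine h.congr_deriv ?_
    have hc : Real.cos x ^ 2 = 1 - Real.sin x ^ 2 := by rw [Real.cos_sq']
    simp only [id, Pi.mul_apply, Pi.div_apply, Pi.sub_apply, Pi.pow_apply]
    field_simp
    push_cast
    ring_nf
    simp only [hc]
    ring
  refine strictMonoOn_of_deriv_pos (convex_Ioo _ _)
    (fun x hx => (hd x hx).continuousAt.continuousWithinAt) fun x hx => ?_
  rw [interior_Ioo] at hx
  rw [(hd x hx).deriv]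
  have := sin_pos_of_mem hx.1 hx.2.le
  have := hx.1
  exact div_pos (slope_numerator_pos hx.1 hx.2.le) (by positivity)

/-- Strict convexity in x⁶, with x allowed to be an endpoint: the gap to the tangent has a
derivative that changes sign only at x₀. -/
lemma cusaBase_tangent_lt {x₀ x : ℝ} (hx₀ : x₀ ∈ Ioo 0 (Real.pi / 2))
    (hx : x ∈ Icc 0 (Real.pi / 2)) (hne : x ≠ x₀) :
    cusaBase x₀ + cusaSlope x₀ * (x ^ 6 - x₀ ^ 6) < cusaBase x := by
  set F : ℝ → ℝ := fun y => cusaBase y - cusaSlope x₀ * y ^ 6 with hF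
  have hcont : ContinuousOn F (Icc 0 (Real.pi / 2)) :=
    continuousOn_cusaBase.sub (by fun_prop)
  have hderiv : ∀ y ∈ Ioo 0 (Real.pi / 2),
      deriv F y = (cusaSlope y - cusaSlope x₀) * (6 * y ^ 5) := fun y hy => by
    have h := (hasDerivAt_cusaBase hy.1 hy.2.le).sub
      ((hasDerivAt_pow 6 y).const_mul (cusaSlope x₀))
    rw [show deriv F y = _ from h.deriv]
    push_cast
    ring
  have hlt : F x₀ < F x := by
    rcases hne.lt_or_gt with h | h
    · refine strictAntiOn_of_deriv_neg (convex_Icc 0 x₀)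
        (hcont.mono (Icc_subset_Icc_right hx₀.2.le)) (fun y hy => ?_)
        ⟨hx.1, h.le⟩ ⟨hx₀.1.le, le_rfl⟩ h
      rw [interior_Icc] at hy
      have hy' : y ∈ Ioo 0 (Real.pi / 2) := ⟨hy.1, hy.2.trans hx₀.2⟩
      rw [hderiv y hy']
      have := hy.1
      exact mul_neg_of_neg_of_pos (sub_neg.2 (strictMonoOn_cusaSlope hy' hx₀ hy.2))
        (by positivity)
    · refine strictMonoOn_of_deriv_pos (convex_Icc x₀ (Real.pi / 2))
        (hcont.mono (Icc_subset_Icc_left hx₀.1.le)) (fun y hy => ?_)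
        ⟨le_rfl, hx₀.2.le⟩ ⟨h.le, hx.2⟩ h
      rw [interior_Icc] at hy
      have hy' : y ∈ Ioo 0 (Real.pi / 2) := ⟨hx₀.1.trans hy.1, hy.2⟩
      rw [hderiv y hy']
      have := hy'.1
      exact mul_pos (sub_pos.2 (strictMonoOn_cusaSlope hx₀ hy' hy.1)) (by positivity)
  simp only [hF] at hlt
  linarith

lemma cusaBase_pi_div_two :
    cusaBase (Real.pi / 2) = cusaB * (Real.pi / 2) ^ 6 := by
  have hpi := Real.pi_ne_zero
  rw [cusaBase_of_ne_zero (by positivity), Real.sin_pi_div_two, Real.cos_pi_div_two, cusaB]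
  field_simp
  ring

lemma cusaBase_lt_chord {x : ℝ} (hx : x ∈ Ioo 0 (Real.pi / 2)) :
    cusaBase x < cusaB * x ^ 6 := by
  have hx0 := hx.1
  have h1 := cusaBase_tangent_lt hx (x := 0) ⟨le_rfl, by linarith [hx.2]⟩ hx.1.ne
  have h2 := cusaBase_tangent_lt hx (x := Real.pi / 2) ⟨by linarith [hx.2], le_rfl⟩ hx.2.ne'
  rw [cusaBase_zero] at h1
  rw [cusaBase_pi_div_two] at h2
  have hpow : x ^ 6 < (Real.pi / 2) ^ 6 := pow_lt_pow_left₀ hx.2 hx0.le (by norm_num)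
  have hx6 : 0 < x ^ 6 := by positivity
  by_contra! h
  -- Weighting `h1` by (π/2)⁶ - x⁶ and `h2` by x⁶ eliminates the slope.
  nlinarith

/-- Near `0` the base function is dominated by `p x⁶` for every `p > 1 / 210`. -/
lemma exists_cusaFamily_neg {p : ℝ} (hp : cusaA < p) :
    ∃ x ∈ Ioo 0 (Real.pi / 2), cusaBase x - p * x ^ 6 < 0 := by
  have bound : ∀ x : ℝ, 0 < x → x ≤ 1 → cusaBase x ≤ cusaA * x ^ 6 + x ^ 8 := by
    intro x h0 h1
    have hsin := sin_pos_of_mem h0 (by linarith [Real.pi_gt_three])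
    have s := sinTaylor_le_sin (n := 3) (by decide) h0.le
    have c := cos_le_cosTaylor (n := 4) (by decide) h0.le
    -- The expansion of 3x / sin x through x⁶, with a generous x⁸ term to absorb the remainder.
    set T := 3 + x ^ 2 / 2 + 7 * x ^ 4 / 120 + 31 * x ^ 6 / 5040 + x ^ 8 / 2 with hT
    have hT0 : 0 ≤ T := by positivity
    have hdiv : 3 * (x / Real.sin x) ≤ T := by
      rw [← mul_div_assoc, div_le_iff₀ hsin]
      refine le_trans ?_ (mul_le_mul_of_nonneg_left s hT0)
      have hy : x ^ 2 ≤ 1 := by nlinarith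
      have hy0 : 0 ≤ x ^ 2 := sq_nonneg x
      have h2 : (x ^ 2) ^ 2 ≤ 1 := pow_le_one₀ hy0 hy
      have h3 : (x ^ 2) ^ 3 ≤ 1 := pow_le_one₀ hy0 hy
      have hfac : 0 ≤ (151007/302400 - 2099/25200 * x ^ 2 + 105809/25401600 * (x ^ 2) ^ 2 - 1/10080 * (x ^ 2) ^ 3) := by
        have := pow_nonneg hy0 2
        have := pow_nonneg hy0 3
        linarith
      have := mul_nonneg (pow_nonneg h0.le 9) hfac
      refine sub_nonneg.1 (this.trans_eq ?_)
      simp only [hT, sinTaylor, Finset.sum_range_succ, Finset.sum_range_zero, Nat.factorial]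
      push_cast
      ring
    have hcos : Real.cos x ≤ 1 - x ^ 2 / 2 + x ^ 4 / 24 - x ^ 6 / 720 + x ^ 8 / 40320 := by
      refine c.trans_eq ?_
      simp only [cosTaylor, Finset.sum_range_succ, Finset.sum_range_zero, Nat.factorial]
      push_cast
      ring
    have hx8 : 0 ≤ x ^ 8 := by positivity
    rw [cusaBase_of_ne_zero h0.ne', cusaA]
    linarith
  have hδ : 0 < p - cusaA := sub_pos.2 hp
  set x := min 1 ((p - cusaA) / 2) with hx
  have h0 : 0 < x := lt_min one_pos (by linarith)
  have h1 : x ≤ 1 := min_le_left _ _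
  have h2 : x ≤ (p - cusaA) / 2 := min_le_right _ _
  refine ⟨x, ⟨h0, by linarith [Real.pi_gt_three]⟩, ?_⟩
  have hb := bound x h0 h1
  have hx6 : 0 < x ^ 6 := by positivity
  have : x ^ 2 < p - cusaA := by nlinarith
  nlinarith

/-! ### Numerical bounds -/

lemma pi_pow_bounds :
    (3.14159265358979323846 : ℝ) ^ 4 ≤ Real.pi ^ 4 ∧
      Real.pi ^ 4 ≤ (3.14159265358979323847 : ℝ) ^ 4 ∧
      (3.14159265358979323846 : ℝ) ^ 6 ≤ Real.pi ^ 6 ∧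
      Real.pi ^ 6 ≤ (3.14159265358979323847 : ℝ) ^ 6 :=
  ⟨pow_le_pow_left₀ (by norm_num) Real.pi_gt_d20.le 4,
    pow_le_pow_left₀ Real.pi_pos.le Real.pi_lt_d20.le 4,
    pow_le_pow_left₀ (by norm_num) Real.pi_gt_d20.le 6,
    pow_le_pow_left₀ Real.pi_pos.le Real.pi_lt_d20.le 6⟩

lemma cusaBase_pi_div_two_eq :
    cusaBase (Real.pi / 2) = 3 * Real.pi / 2 - 4 - Real.pi ^ 4 / 160 := by
  rw [cusaBase_of_ne_zero (by positivity), Real.sin_pi_div_two, Real.cos_pi_div_two]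
  ring

lemma sin_bounds : Real.sin 1.321692 ∈ Icc (0.96913362613263 : ℝ) 0.96913362613264 := by
  constructor
  · refine le_trans ?_ (sinTaylor_le_sin (n := 11) (by decide) (by norm_num))
    norm_num [sinTaylor, Finset.sum_range_succ, Nat.factorial]
  · refine le_trans (sin_le_sinTaylor (n := 10) (by decide) (by norm_num)) ?_
    norm_num [sinTaylor, Finset.sum_range_succ, Nat.factorial]

lemma cos_bounds : Real.cos 1.321692 ∈ Icc (0.24653603123884 : ℝ) 0.24653603123885 := by
  constructor
  · refine le_trans ?_ (cosTaylor_le_cos (n := 11) (by decide) (by norm_num))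
    norm_num [cosTaylor, Finset.sum_range_succ, Nat.factorial]
  · refine le_trans (cos_le_cosTaylor (n := 10) (by decide) (by norm_num)) ?_
    norm_num [cosTaylor, Finset.sum_range_succ, Nat.factorial]

lemma inv_sin_bounds : (Real.sin 1.321692)⁻¹ ∈ Icc (1.03184945092713 : ℝ) 1.03184945092716 := by
  obtain ⟨hl, hu⟩ := sin_bounds
  have h0 : 0 < Real.sin 1.321692 := lt_of_lt_of_le (by norm_num) hl
  constructor
  · rw [le_inv_comm₀ (by norm_num) h0]
    exact hu.trans (by norm_num)
  · rw [inv_le_comm₀ h0 (by norm_num)]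
    exact le_trans (by norm_num) hl

lemma cusaBase_bounds : cusaBase 1.321692 ∈ Icc (0.032742134869 : ℝ) (0.032742134870) := by
  obtain ⟨hl, hu⟩ := inv_sin_bounds
  obtain ⟨cl, cu⟩ := cos_bounds
  rw [cusaBase_of_ne_zero (by norm_num), div_eq_mul_inv]
  constructor <;> norm_num at * <;> linarith

/-- The point 1.321692 approximates t₀, where the slope equals p₀. The slope must exceed 0.0066982,
and does so by less than 10⁻⁹. -/
lemma cusaSlope_bounds : cusaSlope 1.321692 ∈ Icc (0.006698200581 : ℝ) 0.006698200582 := by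
  obtain ⟨hl, hu⟩ := inv_sin_bounds
  obtain ⟨cl, cu⟩ := cos_bounds
  obtain ⟨sl, su⟩ := sin_bounds
  have h0 : 0 ≤ (Real.sin 1.321692)⁻¹ := le_trans (by norm_num) hl
  have c0 : 0 ≤ Real.cos 1.321692 := le_trans (by norm_num) cl
  have hql : (0.24653603123884 : ℝ) * 1.03184945092713 ^ 2 ≤
      Real.cos 1.321692 * (Real.sin 1.321692)⁻¹ ^ 2 :=
    mul_le_mul cl (pow_le_pow_left₀ (by norm_num) hl 2) (by norm_num) c0
  have hqu : Real.cos 1.321692 * (Real.sin 1.321692)⁻¹ ^ 2 ≤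
      (0.24653603123885 : ℝ) * 1.03184945092716 ^ 2 :=
    mul_le_mul cu (pow_le_pow_left₀ h0 hu 2) (by positivity) (by norm_num)
  rw [cusaSlope, div_eq_mul_inv 3 (Real.sin _), div_eq_mul_inv (3 * _ * _), ← inv_pow,
    mul_assoc (3 * _) (Real.cos _)]
  generalize Real.cos 1.321692 * (Real.sin 1.321692)⁻¹ ^ 2 = q at *
  generalize (Real.sin 1.321692)⁻¹ = u at *
  generalize Real.sin 1.321692 = s at *
  constructor
  · rw [le_div_iff₀ (by norm_num)]
    norm_num at *
    linarith
  · rw [div_le_iff₀ (by norm_num)]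
    norm_num at *
    linarith

lemma mem_Ioo_numeric : (1.321692 : ℝ) ∈ Ioo 0 (Real.pi / 2) :=
  ⟨by norm_num, by linarith [Real.pi_gt_d2]⟩

lemma cusaBase_add_ge {x : ℝ} (hx : x ∈ Icc 0 (Real.pi / 2)) :
    0.0066982 * (x ^ 6 + (Real.pi / 2) ^ 6) ≤ cusaBase x + cusaBase (Real.pi / 2) := by
  have htan : cusaBase 1.321692 + cusaSlope 1.321692 * (x ^ 6 - 1.321692 ^ 6) ≤ cusaBase x := by
    rcases eq_or_ne x 1.321692 with rfl | hne
    · simp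
    · exact (cusaBase_tangent_lt mem_Ioo_numeric hx hne).le
  obtain ⟨bl, bu⟩ := cusaBase_bounds
  obtain ⟨ml, mu⟩ := cusaSlope_bounds
  obtain ⟨h4l, h4u, h6l, h6u⟩ := pi_pow_bounds
  rw [cusaBase_pi_div_two_eq, div_pow]
  have hx6 : 0 ≤ x ^ 6 := by have := hx.1; positivity
  -- The coefficient of x⁶ is nonnegative, so only an inequality between constants remains.
  have hm : 0 ≤ (cusaSlope 1.321692 - 0.0066982) * x ^ 6 :=
    mul_nonneg (sub_nonneg.2 (le_trans (by norm_num) ml)) hx6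
  have hpi := Real.pi_gt_d20
  norm_num at *
  linarith

lemma cusaBase_add_numeric_le : cusaBase 1.321692 + cusaBase (Real.pi / 2) ≤
    0.006698203 * (1.321692 ^ 6 + (Real.pi / 2) ^ 6) := by
  obtain ⟨bl, bu⟩ := cusaBase_bounds
  obtain ⟨h4l, h4u, h6l, h6u⟩ := pi_pow_bounds
  rw [cusaBase_pi_div_two_eq, div_pow]
  have hpi := Real.pi_lt_d20
  norm_num at *
  linarith

/-- The factor (π/2)⁶ ≈ 15 amplifies the uncertainty in p, so the digits of d₀ require a sharper
upper bound than p₀ < 0.0066983. -/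
lemma balance_value_bounds {p : ℝ} (hl : 0.0066982 ≤ p) (hu : p ≤ 0.006698203) :
    0.0029637 ≤ cusaBase (Real.pi / 2) - p * (Real.pi / 2) ^ 6 ∧
      cusaBase (Real.pi / 2) - p * (Real.pi / 2) ^ 6 < 0.0029638 := by
  obtain ⟨h4l, h4u, h6l, h6u⟩ := pi_pow_bounds
  have hl' := mul_le_mul_of_nonneg_right hl (show 0 ≤ (Real.pi / 2) ^ 6 by positivity)
  have hu' := mul_le_mul_of_nonneg_right hu (show 0 ≤ (Real.pi / 2) ^ 6 by positivity)
  rw [cusaBase_pi_div_two_eq]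
  have hpi := Real.pi_lt_d20
  have hpi' := Real.pi_gt_d20
  rw [div_pow] at *
  generalize p * (Real.pi ^ 6 / 2 ^ 6) = z at *
  constructor <;> norm_num at * <;> linarith

/-! ### Extremal points of the family -/

lemma hasDerivAt_cusaFamily (p : ℝ) {x : ℝ} (hx : x ∈ Ioo 0 (Real.pi / 2)) :
    HasDerivAt (cusaFamily p) ((cusaSlope x - p) * (6 * x ^ 5)) x := by
  have h := (hasDerivAt_cusaBase hx.1 hx.2.le).sub ((hasDerivAt_pow 6 x).const_mul p)
  refine (h.congr_deriv (by push_cast; ring)).congr_of_eventuallyEq ?_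
  filter_upwards [eventually_ne_nhds hx.1.ne'] with y hy
  simp [cusaFamily_eq p hy]

lemma cusaSlope_eq_of_isLocalExtr {p s : ℝ} (hs : s ∈ Ioo 0 (Real.pi / 2))
    (h : IsLocalExtr (cusaFamily p) s) : cusaSlope s = p := by
  have h0 := h.hasDerivAt_eq_zero (hasDerivAt_cusaFamily p hs)
  have hs0 := hs.1
  have : (6 * s ^ 5) ≠ 0 := by positivity
  exact sub_eq_zero.1 ((mul_eq_zero.1 h0).resolve_right this)

lemma IsMinPoint.isLocalExtr {f : ℝ → ℝ} {a b t : ℝ} (h : IsMinPoint f a b t) :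
    IsLocalExtr f t :=
  Or.inl (h.2.isLocalMin (Ioo_mem_nhds h.1.1 h.1.2))

lemma exists_isMinPoint {p : ℝ} (hp : p ∈ Ioo cusaA cusaB) :
    ∃ t, IsMinPoint (cusaFamily p) 0 (Real.pi / 2) t := by
  have hpi := Real.pi_pos
  obtain ⟨x, hx, hneg⟩ := exists_cusaFamily_neg hp.1
  obtain ⟨t, ht, hmin⟩ := isCompact_Icc.exists_isMinOn
    (nonempty_Icc.2 (show 0 ≤ Real.pi / 2 by positivity))
    (continuousOn_cusaBase.sub (by fun_prop : ContinuousOn (fun x => p * x ^ 6) _))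
  have htx : cusaBase t - p * t ^ 6 ≤ cusaBase x - p * x ^ 6 := hmin ⟨hx.1.le, hx.2.le⟩
  have ht0 : 0 < t := by
    refine ht.1.lt_of_ne ?_
    rintro rfl
    rw [cusaBase_zero] at htx
    linarith
  have ht1 : t < Real.pi / 2 := by
    refine ht.2.lt_of_ne ?_
    rintro rfl
    rw [cusaBase_pi_div_two] at htx
    have := mul_pos (sub_pos.2 hp.2) (show 0 < (Real.pi / 2) ^ 6 by positivity)
    linarith
  refine ⟨t, ⟨ht0, ht1⟩, fun y hy => ?_⟩
  change cusaFamily p t ≤ cusaFamily p y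
  rw [cusaFamily_eq p ht0.ne', cusaFamily_eq p hy.1.ne']
  exact hmin ⟨hy.1.le, hy.2.le⟩

lemma tendsto_cusaFamily (p : ℝ) :
    Tendsto (cusaFamily p) (𝓝[<] (Real.pi / 2))
      (𝓝 (cusaBase (Real.pi / 2) - p * (Real.pi / 2) ^ 6)) := by
  rw [← cusaFamily_eq p (by positivity)]
  refine ContinuousAt.continuousWithinAt ?_
  have : Real.sin (Real.pi / 2) ≠ 0 := by simp
  unfold cusaFamily
  fun_prop (disch := assumption)

/-! ### The balanced parameter -/

/-- The equioscillation property: the minimum of `φ_p` is the negative of its endpoint value. -/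
lemma exists_balanced : ∃ p₀ t₀ : ℝ, t₀ ∈ Ioo 0 (Real.pi / 2) ∧
    0.0066982 ≤ p₀ ∧ p₀ ≤ 0.006698203 ∧
    cusaBase t₀ - p₀ * t₀ ^ 6 = -(cusaBase (Real.pi / 2) - p₀ * (Real.pi / 2) ^ 6) ∧
    ∀ x ∈ Icc 0 (Real.pi / 2), cusaBase t₀ - p₀ * t₀ ^ 6 ≤ cusaBase x - p₀ * x ^ 6 := by
  have hpi := Real.pi_pos
  have hc : 0 < (Real.pi / 2) ^ 6 := by positivity
  have hden : ∀ x ∈ Icc 0 (Real.pi / 2), 0 < x ^ 6 + (Real.pi / 2) ^ 6 := fun x hx => by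
    have := hx.1
    positivity
  obtain ⟨t, ht, hmin⟩ := isCompact_Icc.exists_isMinOn
    (nonempty_Icc.2 (show 0 ≤ Real.pi / 2 by positivity))
    ((continuousOn_cusaBase.add continuousOn_const).div
      (by fun_prop : ContinuousOn (fun x => x ^ 6 + (Real.pi / 2) ^ 6) _)
      fun x hx => (hden x hx).ne' :
      ContinuousOn (fun x => (cusaBase x + cusaBase (Real.pi / 2)) /
        (x ^ 6 + (Real.pi / 2) ^ 6)) (Icc 0 (Real.pi / 2)))
  set p := (cusaBase t + cusaBase (Real.pi / 2)) / (t ^ 6 + (Real.pi / 2) ^ 6) with hp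
  have heq : p * (t ^ 6 + (Real.pi / 2) ^ 6) = cusaBase t + cusaBase (Real.pi / 2) :=
    div_mul_cancel₀ _ (hden t ht).ne'
  have hle : ∀ x ∈ Icc 0 (Real.pi / 2),
      p * (x ^ 6 + (Real.pi / 2) ^ 6) ≤ cusaBase x + cusaBase (Real.pi / 2) := fun x hx =>
    (le_div_iff₀ (hden x hx)).1 (hmin hx)
  have hl : 0.0066982 ≤ p := (le_div_iff₀ (hden t ht)).2 (cusaBase_add_ge ht)
  have hu : p ≤ 0.006698203 := by
    have hx : (1.321692 : ℝ) ∈ Icc 0 (Real.pi / 2) := Ioo_subset_Icc_self mem_Ioo_numeric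
    exact le_of_mul_le_mul_right ((hle _ hx).trans cusaBase_add_numeric_le) (hden _ hx)
  have hd := (balance_value_bounds hl hu).1
  have hd0 : 0 < cusaBase (Real.pi / 2) - p * (Real.pi / 2) ^ 6 :=
    lt_of_lt_of_le (by norm_num) hd
  refine ⟨p, t, ⟨ht.1.lt_of_ne ?_, ht.2.lt_of_ne ?_⟩, hl, hu, by linarith, fun x hx => ?_⟩
  -- At either endpoint `heq` would force the endpoint value to vanish.
  · intro h
    rw [← h, cusaBase_zero] at heq
    linarith
  · intro h
    rw [h] at heq
    linarith
  · linarith [hle x hx]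

lemma cusaFamily_le_endpoint {p x : ℝ} (hp : p < cusaB) (hx : x ∈ Ioo 0 (Real.pi / 2)) :
    cusaFamily p x ≤ cusaBase (Real.pi / 2) - p * (Real.pi / 2) ^ 6 := by
  have h1 := cusaBase_lt_chord hx
  have hpow : x ^ 6 ≤ (Real.pi / 2) ^ 6 := pow_le_pow_left₀ hx.1.le hx.2.le 6
  have := mul_le_mul_of_nonneg_left hpow (sub_pos.2 hp).le
  rw [cusaFamily_eq p hx.1.ne', cusaBase_pi_div_two]
  linarith

lemma le_familyError (φ : ℝ → ℝ → ℝ) {a b x : ℝ} (p : ℝ) (hx : x ∈ Ioo a b) :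
    ((|φ p x| : ℝ) : EReal) ≤ familyError φ a b p :=
  le_iSup₂ (f := fun x (_ : x ∈ Ioo a b) => ((|φ p x| : ℝ) : EReal)) x hx

lemma lt_familyError_of_tendsto {φ : ℝ → ℝ → ℝ} {a b p d l : ℝ} (hab : a < b)
    (h : Tendsto (φ p) (𝓝[<] b) (𝓝 l)) (hd : d < l) : (d : EReal) < familyError φ a b p := by
  obtain ⟨x, hx, hdx⟩ := ((eventually_mem_set.2 (Ioo_mem_nhdsLT hab)).and
    (h.eventually_const_lt hd)).exists
  exact lt_of_lt_of_le (EReal.coe_lt_coe_iff.2 (hdx.trans_le (le_abs_self _)))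
    (le_familyError φ p hx)

theorem mainTheorem10 :
    (∀ p ∈ Ioo cusaA cusaB, ∃ t : ℝ,
      IsMinPoint (cusaFamily p) 0 (Real.pi / 2) t ∧
      ∀ s ∈ Ioo (0 : ℝ) (Real.pi / 2), IsLocalExtr (cusaFamily p) s → s = t) ∧
    ∃ p₀ t₀ d₀ : ℝ,
      p₀ ∈ Ioo cusaA cusaB ∧
      SolvesBalanceEquation cusaFamily 0 (Real.pi / 2) p₀ ∧
      (∀ p ∈ Ioo cusaA cusaB,
        SolvesBalanceEquation cusaFamily 0 (Real.pi / 2) p → p = p₀) ∧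
      (0.0066982 : ℝ) ≤ p₀ ∧ p₀ < (0.0066983 : ℝ) ∧
      IsMinPoint (cusaFamily p₀) 0 (Real.pi / 2) t₀ ∧
      d₀ = |cusaFamily p₀ t₀| ∧
      Tendsto (cusaFamily p₀) (𝓝[<] (Real.pi / 2)) (𝓝 d₀) ∧
      (0.0029637 : ℝ) ≤ d₀ ∧ d₀ < (0.0029638 : ℝ) ∧
      (d₀ : EReal) = minimaxError cusaFamily 0 (Real.pi / 2) ∧
      IsMinimaxApproximant cusaFamily 0 (Real.pi / 2) p₀ := by
  refine ⟨fun p hp => ?_, ?_⟩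
  · obtain ⟨t, ht⟩ := exists_isMinPoint hp
    refine ⟨t, ht, fun s hs hext => strictMonoOn_cusaSlope.injOn hs ht.1 ?_⟩
    rw [cusaSlope_eq_of_isLocalExtr hs hext, cusaSlope_eq_of_isLocalExtr ht.1 ht.isLocalExtr]
  obtain ⟨p₀, t₀, ht₀, hl, hu, heq, hmin⟩ := exists_balanced
  obtain ⟨hdl, hdu⟩ := balance_value_bounds hl hu
  have hpi := Real.pi_pos
  have hc : 0 < (Real.pi / 2) ^ 6 := by positivity
  have ht6 : 0 < t₀ ^ 6 := pow_pos ht₀.1 6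
  set d₀ := cusaBase (Real.pi / 2) - p₀ * (Real.pi / 2) ^ 6 with hd₀
  have hd0 : 0 < d₀ := lt_of_lt_of_le (by norm_num) hdl
  have hval : ∀ p, cusaFamily p t₀ = -d₀ - (p - p₀) * t₀ ^ 6 := fun p => by
    rw [cusaFamily_eq p ht₀.1.ne']
    linarith
  have habs : |cusaFamily p₀ t₀| = d₀ := by
    rw [hval, sub_self, zero_mul, sub_zero, abs_neg, abs_of_pos hd0]
  have hB : p₀ < cusaB := by
    rw [hd₀, cusaBase_pi_div_two, ← sub_mul] at hd0
    exact sub_pos.1 (pos_of_mul_pos_left hd0 hc.le)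
  have hA : cusaA < p₀ := lt_of_lt_of_le (by norm_num [cusaA]) hl
  have hminpt : IsMinPoint (cusaFamily p₀) 0 (Real.pi / 2) t₀ := by
    refine ⟨ht₀, fun x hx => ?_⟩
    change cusaFamily p₀ t₀ ≤ cusaFamily p₀ x
    rw [cusaFamily_eq p₀ ht₀.1.ne', cusaFamily_eq p₀ hx.1.ne']
    exact hmin x ⟨hx.1.le, hx.2.le⟩
  have hlower : ∀ x ∈ Ioo 0 (Real.pi / 2), -d₀ ≤ cusaFamily p₀ x := fun x hx => by
    have h : cusaFamily p₀ t₀ ≤ cusaFamily p₀ x := hminpt.2 hx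
    rwa [hval, sub_self, zero_mul, sub_zero] at h
  have herr : familyError cusaFamily 0 (Real.pi / 2) p₀ = d₀ := by
    refine le_antisymm (iSup₂_le fun x hx => EReal.coe_le_coe_iff.2 ?_) ?_
    · exact abs_le.2 ⟨hlower x hx, cusaFamily_le_endpoint hB hx⟩
    · rw [← habs]
      exact le_familyError cusaFamily p₀ ht₀
  have hstrict : ∀ p, p ≠ p₀ → (d₀ : EReal) < familyError cusaFamily 0 (Real.pi / 2) p := by
    intro p hp
    rcases hp.lt_or_gt with h | h
    · refine lt_familyError_of_tendsto (by positivity) (tendsto_cusaFamily p) ?_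
      have := mul_lt_mul_of_pos_right h hc
      linarith
    · refine lt_of_lt_of_le (EReal.coe_lt_coe_iff.2 ?_) (le_familyError cusaFamily p ht₀)
      have := mul_pos (sub_pos.2 h) ht6
      rw [hval]
      exact lt_of_lt_of_le (by linarith) (neg_le_abs _)
  have hp₀ : 0 < p₀ := lt_of_lt_of_le (by norm_num) hl
  have hinf : minimaxError cusaFamily 0 (Real.pi / 2) = d₀ := by
    refine le_antisymm ((iInf₂_le p₀ hp₀).trans_eq herr) (le_iInf₂ fun p _ => ?_)
    rcases eq_or_ne p p₀ with rfl | h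
    · exact herr.ge
    · exact (hstrict p h).le
  refine ⟨p₀, t₀, d₀, ⟨hA, hB⟩, ⟨t₀, hminpt, ?_⟩, ?_, hl, lt_of_le_of_lt hu (by norm_num),
    hminpt, habs.symm, tendsto_cusaFamily p₀, hdl, hdu, hinf.symm, hp₀, herr.trans hinf.symm,
    fun p _ h => ?_⟩
  · rw [habs]
    exact tendsto_cusaFamily p₀
  · rintro p hp ⟨t, ht, hlim⟩
    have hbal := tendsto_nhds_unique hlim (tendsto_cusaFamily p)
    obtain ⟨x, hx, hneg⟩ := exists_cusaFamily_neg hp.1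
    rw [← cusaFamily_eq p hx.1.ne'] at hneg
    have hneg' : cusaFamily p t < 0 := lt_of_le_of_lt (ht.2 hx) hneg
    rw [abs_of_neg hneg'] at hbal
    -- As p grows, both the endpoint value and the minimum decrease strictly, so their sum vanishes
    -- only at p₀.
    rcases lt_trichotomy p p₀ with h | h | h
    · have h1 := hlower t ht.1
      have h2 := mul_lt_mul_of_pos_right h hc
      have h3 := mul_lt_mul_of_pos_right h (pow_pos ht.1.1 6)
      rw [cusaFamily_eq _ ht.1.1.ne'] at h1 hbal
      linarith
    · exact h
    · have h1 : cusaFamily p t ≤ cusaFamily p t₀ := ht.2 ht₀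
      rw [hval] at h1
      have h2 := mul_lt_mul_of_pos_right h hc
      have h3 := mul_pos (sub_pos.2 h) ht6
      linarith
  · by_contra hne
    exact (hstrict p hne).ne (h.trans hinf).symm
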